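/- Let $d\ge 1$ and let $\tau=\frac1d\operatorname{tr}$ be the normalized trace on $M_d(\mathbb C)$, with the inner product $\langle x,y\rangle=\tau(x^*y)$. The depolarizing semigroup $$P_t a=e^{-t}a+(1-e^{-t})\tau(a)\mathbf 1,\qquad t\ge 0,\ a\in M_d(\mathbb C),$$ is a quantum Markov semigroup (a continuous semigroup of unital completely positive maps with $P_0=\mathrm{id}$), it is symmetric, i.e. $\tau(P_t(x)y)=\tau(xP_t(y))$, and its generator $\mathcal L x=\lim_{t\searrow 0}\frac1t(x-P_tx)$ admits a Lindblad form $\mathcal L=\sum_{j=1}^n\partial_j^\dagger\partial_j$ with $\partial_j=[v_j,\cdot\,]$, $\partial_j^\dagger=[v_j^*,\cdot\,]$, $v_j\in M_d(\mathbb C)$, $\{v_j\}=\{v_j^*\}$. Moreover: (1) Gradient estimate $\mathrm{GE}(1/2,2d)$ for every operator mean. Let $\Lambda$ be an operator mean in the sense of Kubo and Ando, i.e. a map $B(H)_+\times B(H)_+\to B(H)_+$ for an infinite-dimensional Hilbert space $H$ that is monotone, satisfies $C\Lambda(A,B)C\le\Lambda(CAC,CBC)$ for $A,B,C\in B(H)_+$,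 is continuous along decreasing strongly convergent sequences, and has $\Lambda(\mathrm{id},\mathrm{id})=\mathrm{id}$. For $A,B$ positive on a finite-dimensional Hilbert space put $\Lambda(A,B)=V^*\Lambda(VAV^*,VBV^*)V$, where $V$ is an isometric embedding into $H$. For $\rho\ge 0$ in $M_d(\mathbb C)$ let $\hat\rho=\Lambda(L(\rho),R(\rho))$, where $L(\rho),R(\rho)$ are left and right multiplication by $\rho$. For every Lindblad form of $\mathcal L$ put $\|\partial a\|_\rho^2=\sum_j\langle\hat\rho\,\partial_ja,\partial_ja\rangle$. Then, for every choice of $V$, with $K=\frac12$ and $N=2d$, $$\|\partial P_ta\|_\rho^2\le e^{-2Kt}\|\partial a\|_{P_t\rho}^2-\frac{1-e^{-2Kt}}{KN}\,\bigl|\langle a,\mathcal L P_t\rho\rangle\bigr|^2$$ for all $t\ge0$, all $a\in M_d(\mathbb C)$ and all positive invertible $\rho\in M_d(\mathbb C)$ with $\tau(\rho)=1$. (2) Bakry–Émery condition $\mathrm{BE}(1/2,2d)$. With $$\Gamma(a,b)=\tfrac12\bigl(a^*\mathcal Lb+(\mathcal La)^*b-\mathcal L(a^*b)\bigr),\qquad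 \Gamma_2(a,b)=\tfrac12\bigl(\Gamma(a,\mathcal Lb)+\Gamma(\mathcal La,b)-\mathcal L\Gamma(a,b)\bigr),$$ one has, for every $a\in M_d(\mathbb C)$, $$\Gamma_2(a,a)\ge\tfrac12\,\Gamma(a,a)+\tfrac1{2d}\,(\mathcal La)^*(\mathcal La).$$ -/

import Mathlib

open Filter Topology Matrix
open scoped ComplexOrder

noncomputable section

namespace QMS

/-! ### The matrix algebra with its normalized trace -/

/-- The matrix algebra `M_d(ℂ)`. -/
abbrev Mat (d : ℕ) : Type := Matrix (Fin d) (Fin d) ℂ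

/-- The normalized trace `τ` on `M_d(ℂ)`. -/
def ntr {d : ℕ} (a : Mat d) : ℂ := (d : ℂ)⁻¹ * a.trace

/-- The inner product `⟨x, y⟩ = τ(x* y)`. -/
def ip {d : ℕ} (x y : Mat d) : ℂ := ntr (xᴴ * y)

/-- `𝒮₊(M_d(ℂ))`: positive invertible matrices `ρ` with `τ(ρ) = 1`. -/
def IsInvertibleDensity {d : ℕ} (ρ : Mat d) : Prop := ρ.PosDef ∧ ntr ρ = 1

/-! ### Quantum Markov semigroups -/

/-- Complete positivity: every amplification maps positive block matrices to positive ones. -/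
def IsCompletelyPositive {d : ℕ} (Φ : Mat d →ₗ[ℂ] Mat d) : Prop :=
  ∀ (n : ℕ) (X : Matrix (Fin n) (Fin n) (Mat d)),
    (Matrix.comp (Fin n) (Fin n) (Fin d) (Fin d) ℂ X).PosSemidef →
    (Matrix.comp (Fin n) (Fin n) (Fin d) (Fin d) ℂ (X.map Φ)).PosSemidef

/-- Quantum Markov semigroups; only the values `P t` with `0 ≤ t` matter. -/
structure IsQuantumMarkovSemigroup {d : ℕ} (P : ℝ → Mat d →ₗ[ℂ] Mat d) : Prop where
  zero : P 0 = LinearMap.id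
  add : ∀ s t : ℝ, 0 ≤ s → 0 ≤ t → P (s + t) = P s ∘ₗ P t
  completelyPositive : ∀ t : ℝ, 0 ≤ t → IsCompletelyPositive (P t)
  unital : ∀ t : ℝ, 0 ≤ t → P t 1 = 1
  continuous : ∀ x : Mat d, ContinuousOn (fun t : ℝ => P t x) (Set.Ici 0)

def IsTraciallySymmetric {d : ℕ} (P : ℝ → Mat d →ₗ[ℂ] Mat d) : Prop :=
  ∀ t : ℝ, 0 ≤ t → ∀ x y : Mat d, ntr (P t x * y) = ntr (x * P t y)

/-- `𝓛` is the generator of `P`, with the sign convention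
`𝓛 x = lim_{t ↘ 0} (x - P_t x) / t`, that is, `P_t = exp (-t 𝓛)`. -/
def IsGenerator {d : ℕ} (P : ℝ → Mat d →ₗ[ℂ] Mat d) (𝓛 : Mat d →ₗ[ℂ] Mat d) : Prop :=
  ∀ x : Mat d, Tendsto (fun t : ℝ => t⁻¹ • (x - P t x)) (𝓝[>] 0) (𝓝 (𝓛 x))

/-! ### The Bakry–Émery condition -/

/-- The carré du champ operator. -/
def Gam {d : ℕ} (𝓛 : Mat d →ₗ[ℂ] Mat d) (a b : Mat d) : Mat d :=
  (1 / 2 : ℝ) • (aᴴ * 𝓛 b + (𝓛 a)ᴴ * b - 𝓛 (aᴴ * b))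

/-- The iterated carré du champ operator. -/
def Gam2 {d : ℕ} (𝓛 : Mat d →ₗ[ℂ] Mat d) (a b : Mat d) : Mat d :=
  (1 / 2 : ℝ) • (Gam 𝓛 a (𝓛 b) + Gam 𝓛 (𝓛 a) b - 𝓛 (Gam 𝓛 a b))

/-- `BE(K, N)` for finite `N`: `P` is a quantum Markov semigroup, and its generator satisfies
`Γ₂(a) ≥ K Γ(a) + (1/N) |𝓛 a|²` for all `a`. -/
def SatisfiesBE {d : ℕ} (P : ℝ → Mat d →ₗ[ℂ] Mat d) (K N : ℝ) : Prop :=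
  IsQuantumMarkovSemigroup P ∧
  ∃ 𝓛 : Mat d →ₗ[ℂ] Mat d, IsGenerator P 𝓛 ∧
    ∀ a : Mat d, (Gam2 𝓛 a a - (K • Gam 𝓛 a a + (1 / N) • ((𝓛 a)ᴴ * 𝓛 a))).PosSemidef

/-! ### Operator means -/

section Means

variable {H : Type*} [NormedAddCommGroup H] [InnerProductSpace ℂ H] [CompleteSpace H]

/-- `A_n ↘ A`: the sequence decreases in the Loewner order and converges strongly to `A`. -/
def DecreasesTo (A : ℕ → H →L[ℂ] H) (A' : H →L[ℂ] H) : Prop :=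
  Antitone A ∧ ∀ x : H, Tendsto (fun n => A n x) atTop (𝓝 (A' x))

/-- Operator means in the sense of Kubo and Ando on the positive bounded operators on `H`
(for `H` infinite-dimensional); the order is the Loewner order, and the values of `toFun` at
operators that are not positive play no role. -/
structure OperatorMean (H : Type*) [NormedAddCommGroup H] [InnerProductSpace ℂ H]
    [CompleteSpace H] where
  toFun : (H →L[ℂ] H) → (H →L[ℂ] H) → (H →L[ℂ] H)
  nonneg : ∀ A B, 0 ≤ A → 0 ≤ B → 0 ≤ toFun A B
  mono : ∀ A B C D, 0 ≤ A → 0 ≤ B → 0 ≤ C → 0 ≤ D → A ≤ C → B ≤ D → toFun A B ≤ toFun C D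
  transformer : ∀ A B C, 0 ≤ A → 0 ≤ B → 0 ≤ C →
    C ∘L toFun A B ∘L C ≤ toFun (C ∘L A ∘L C) (C ∘L B ∘L C)
  continuous : ∀ (A B : ℕ → H →L[ℂ] H) (A' B' : H →L[ℂ] H),
    (∀ n, 0 ≤ A n) → (∀ n, 0 ≤ B n) → 0 ≤ A' → 0 ≤ B' →
    DecreasesTo A A' → DecreasesTo B B' →
    DecreasesTo (fun n => toFun (A n) (B n)) (toFun A' B')
  map_id : toFun (ContinuousLinearMap.id ℂ H) (ContinuousLinearMap.id ℂ H) =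
    ContinuousLinearMap.id ℂ H

/-- The mean of operators on another Hilbert space `E`, through an isometric
embedding `V` of `E` into `H`: `V* Λ(V A V*, V B V*) V`. -/
def OperatorMean.onSubspace {E : Type*} [NormedAddCommGroup E] [InnerProductSpace ℂ E]
    [CompleteSpace E] (Λ : OperatorMean H) (V : E →ₗᵢ[ℂ] H) (A B : E →L[ℂ] E) : E →L[ℂ] E :=
  let W : E →L[ℂ] H := V.toContinuousLinearMap
  let W' : H →L[ℂ] E := ContinuousLinearMap.adjoint W
  W' ∘L Λ.toFun (W ∘L A ∘L W') (W ∘L B ∘L W') ∘L W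

end Means

/-! ### The Hilbert space `L₂(M_d(ℂ), τ)` and the operators `ρ̂` -/

/-- The Hilbert space `L₂(M_d(ℂ), τ)`, in coordinates. -/
abbrev L2 (d : ℕ) : Type := EuclideanSpace ℂ (Fin d × Fin d)

/-- A matrix seen as a vector of `L₂(M_d(ℂ), τ)`; see `inner_toL2`. -/
def toL2 (d : ℕ) : Mat d →ₗ[ℂ] L2 d where
  toFun a := WithLp.toLp 2 fun p => ((Real.sqrt d : ℝ) : ℂ)⁻¹ * a p.1 p.2
  map_add' a b := by ext p; simp [mul_add]
  map_smul' c a := by ext p; simp; ring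

/-- The inverse of `toL2`. -/
def ofL2 (d : ℕ) : L2 d →ₗ[ℂ] Mat d where
  toFun ξ := Matrix.of fun i j => ((Real.sqrt d : ℝ) : ℂ) * ξ (i, j)
  map_add' a b := by ext i j; simp [mul_add]
  map_smul' c a := by ext i j; simp; ring

theorem ofL2_toL2 {d : ℕ} (a : Mat d) : ofL2 d (toL2 d a) = a := by
  ext i j
  have hd : (0 : ℝ) < d := by exact_mod_cast Fin.pos i
  have h : ((Real.sqrt d : ℝ) : ℂ) ≠ 0 := by exact_mod_cast (Real.sqrt_pos.2 hd).ne'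
  simp [ofL2, toL2, h]

theorem toL2_ofL2 {d : ℕ} (ξ : L2 d) : toL2 d (ofL2 d ξ) = ξ := by
  ext p
  have hd : (0 : ℝ) < d := by exact_mod_cast Fin.pos p.1
  have h : ((Real.sqrt d : ℝ) : ℂ) ≠ 0 := by exact_mod_cast (Real.sqrt_pos.2 hd).ne'
  simp [ofL2, toL2, h]

theorem inner_toL2 {d : ℕ} (a b : Mat d) : inner ℂ (toL2 d a) (toL2 d b) = ip a b := by
  have h : (((Real.sqrt d : ℝ) : ℂ))⁻¹ * (((Real.sqrt d : ℝ) : ℂ))⁻¹ = (d : ℂ)⁻¹ := by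
    rw [← mul_inv, ← Complex.ofReal_mul, Real.mul_self_sqrt (Nat.cast_nonneg d)]; simp
  simp only [ip, ntr, toL2, PiLp.inner_apply, Matrix.trace, Matrix.diag, Matrix.mul_apply,
    Matrix.conjTranspose_apply, LinearMap.coe_mk, AddHom.coe_mk, Fintype.sum_prod_type]
  rw [Finset.sum_comm, Finset.mul_sum]
  refine Finset.sum_congr rfl fun j _ => ?_
  rw [Finset.mul_sum]
  refine Finset.sum_congr rfl fun i _ => ?_
  rw [← h]
  simp
  ring

/-- An operator on `M_d(ℂ)` as a bounded operator on `L₂(M_d(ℂ), τ)`. -/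
def onL2 {d : ℕ} (T : Mat d →ₗ[ℂ] Mat d) : L2 d →L[ℂ] L2 d :=
  LinearMap.toContinuousLinearMap (toL2 d ∘ₗ T ∘ₗ ofL2 d)

/-- `ρ̂ = Λ(L(ρ), R(ρ))`, with `L(ρ)`, `R(ρ)` the left and right multiplications by `ρ`. -/
def hat {d : ℕ} {H : Type*} [NormedAddCommGroup H] [InnerProductSpace ℂ H] [CompleteSpace H]
    (Λ : OperatorMean H) (V : L2 d →ₗᵢ[ℂ] H) (ρ : Mat d) : Mat d →ₗ[ℂ] Mat d :=
  ofL2 d ∘ₗ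
    (Λ.onSubspace V (onL2 (LinearMap.mulLeft ℂ ρ)) (onL2 (LinearMap.mulRight ℂ ρ))).toLinearMap ∘ₗ
    toL2 d

/-! ### The gradient estimate -/

/-- The partial derivative `∂ = [v, ·]`. -/
def partialDeriv {d : ℕ} (v : Mat d) : Mat d →ₗ[ℂ] Mat d :=
  LinearMap.mulLeft ℂ v - LinearMap.mulRight ℂ v

/-- `∑_j ∂_j† ∂_j` with `∂_j = [v_j, ·]` and `∂_j† = [v_j*, ·]`. -/
def lindblad {d n : ℕ} (v : Fin n → Mat d) : Mat d →ₗ[ℂ] Mat d :=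
  ∑ j, partialDeriv (v j)ᴴ ∘ₗ partialDeriv (v j)

/-- The generator of `P` has the Lindblad form `∑_j ∂_j† ∂_j` given by the family `v`,
where `{v_j} = {v_j*}`. -/
def IsLindbladForm {d n : ℕ} (P : ℝ → Mat d →ₗ[ℂ] Mat d) (v : Fin n → Mat d) : Prop :=
  Set.range v = Set.range (fun j => (v j)ᴴ) ∧ IsGenerator P (lindblad v)

/-- `‖∂ a‖_ρ² = ⟨ρ̂ ∂ a, ∂ a⟩ = ∑_j ⟨ρ̂ ∂_j a, ∂_j a⟩` (which is real). -/
def gradNormSq {d n : ℕ} {H : Type*} [NormedAddCommGroup H] [InnerProductSpace ℂ H]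
    [CompleteSpace H] (Λ : OperatorMean H) (V : L2 d →ₗᵢ[ℂ] H) (v : Fin n → Mat d)
    (ρ a : Mat d) : ℝ :=
  (∑ j, ip (hat Λ V ρ (partialDeriv (v j) a)) (partialDeriv (v j) a)).re

/-- `(1 - e^{-2Kt}) / (K N)`, read as its limit `2 t / N` when `K = 0`. -/
def dimCoeff (K N t : ℝ) : ℝ :=
  if K = 0 then 2 * t / N else (1 - Real.exp (-2 * K * t)) / (K * N)

/-- `GE(K, N)` for the operator mean `Λ` and finite `N`. The semigroup is symmetric, its generator
has a Lindblad form, and the gradient estimate holds for every choice of the Lindblad form and of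
the embedding of `L₂(M_d(ℂ), τ)` into `H`. Here `ip a (lindblad v b)` is `ℰ(a, b) = ⟨a, 𝓛 b⟩`. -/
def SatisfiesGE {d : ℕ} {H : Type*} [NormedAddCommGroup H] [InnerProductSpace ℂ H]
    [CompleteSpace H] (Λ : OperatorMean H) (P : ℝ → Mat d →ₗ[ℂ] Mat d) (K N : ℝ) : Prop :=
  IsQuantumMarkovSemigroup P ∧ IsTraciallySymmetric P ∧
  (∃ (n : ℕ) (v : Fin n → Mat d), IsLindbladForm P v) ∧
  ∀ (n : ℕ) (v : Fin n → Mat d), IsLindbladForm P v →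
    ∀ (V : L2 d →ₗᵢ[ℂ] H) (t : ℝ), 0 ≤ t → ∀ a ρ : Mat d, IsInvertibleDensity ρ →
      gradNormSq Λ V v ρ (P t a) ≤
        Real.exp (-2 * K * t) * gradNormSq Λ V v (P t ρ) a -
          dimCoeff K N t * ‖ip a (lindblad v (P t ρ))‖ ^ 2

/-- The depolarizing semigroup `P_t a = e^{-t} a + (1 - e^{-t}) τ(a) 1`. -/
def depolarizing (d : ℕ) (t : ℝ) : Mat d →ₗ[ℂ] Mat d where
  toFun a := Real.exp (-t) • a + ((1 - Real.exp (-t) : ℝ) * ntr a) • (1 : Mat d)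
  map_add' a b := by
    simp only [ntr, Matrix.trace_add, smul_add, mul_add, add_smul]; abel
  map_smul' c a := by
    simp only [ntr, Matrix.trace_smul, smul_eq_mul, RingHom.id_apply, smul_add, smul_smul]
    rw [smul_comm]; congr 2; ring

end QMS

end

namespace QMS

open scoped InnerProduct

/-! ### Superadditivity of operator means -/

section OperatorMeans

variable {H : Type*} [NormedAddCommGroup H] [InnerProductSpace ℂ H] [CompleteSpace H]
variable {E : Type*} [NormedAddCommGroup E] [InnerProductSpace ℂ E] [CompleteSpace E]

/-! Write e = exp(-t) and L a = a - τ(a)1. Then L is an orthogonal projection and generates the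
semigroup.

Gradient estimate: commutators kill 1, so ∂P_t a = e ∂a and the left side is e²‖∂a‖_ρ². Since P_t ρ
= eρ + (1-e)1, concavity and normalization of the mean give ‖∂a‖²_{P_t ρ} ≥ e‖∂a‖_ρ² + (1-e)‖La‖²
(`ip_hat_comb_ge`), because ∑⟨∂_j a, ∂_j a⟩ = ⟨a, La⟩ = ‖La‖². After multiplication by exp(-2Kt) =
e, the surplus e(1-e)‖La‖² absorbs the dimension term (1-e)/d · e²|⟨La, Lρ⟩|², by Cauchy–Schwarz and
‖Lρ‖² = τ(ρ²) - 1 ≤ d.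

Concavity rests on superadditivity (`OperatorMean.compress_add_le`). Two copies of E with orthogonal
ranges fit into H; the mean of block diagonal operators is block diagonal by locality, and the
transformer inequality for the map that folds one copy onto the other compares the sum of the blocks
with the mean of the sums.

Bakry–Émery: with y = (La)*(La), the difference of the two sides is (tr(y)1 - y)/(2d), which is
positive by `posSemidef_trace_smul_one_sub`. -/

theorem comp_adjoint_self_nonneg (S : E →L[ℂ] H) : 0 ≤ S ∘L S† :=
  (ContinuousLinearMap.nonneg_iff_isPositive _).2
    (ContinuousLinearMap.isPositive_self_comp_adjoint S)

theorem conj_nonneg {A : E →L[ℂ] E} (hA : 0 ≤ A) (S : E →L[ℂ] H) : 0 ≤ S ∘L A ∘L S† :=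
  (ContinuousLinearMap.nonneg_iff_isPositive _).2
    (((ContinuousLinearMap.nonneg_iff_isPositive _).1 hA).conj_adjoint S)

theorem conj_mono {A B : E →L[ℂ] E} (h : A ≤ B) (S : E →L[ℂ] H) :
    S ∘L A ∘L S† ≤ S ∘L B ∘L S† := by
  rw [← sub_nonneg] at h ⊢
  convert conj_nonneg h S using 1
  ext x; simp

theorem adjoint_eq_of_nonneg {A : H →L[ℂ] H} (hA : 0 ≤ A) : A† = A :=
  ((ContinuousLinearMap.nonneg_iff_isPositive _).1 hA).isSelfAdjoint.adjoint_eq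

/-- If the compression of a positive operator is nonpositive, the operator vanishes there. -/
theorem comp_eq_zero_of_conj_nonpos {D : H →L[ℂ] H} (hD : 0 ≤ D) {P : E →L[ℂ] H}
    (h : P† ∘L D ∘L P ≤ 0) : D ∘L P = 0 := by
  obtain ⟨S, rfl⟩ := CStarAlgebra.nonneg_iff_eq_star_mul_self.1 hD
  ext x
  have h1 := ((ContinuousLinearMap.le_def _ _).1 h).re_inner_nonneg_left x
  have h2 : ‖S (P x)‖ ^ 2 ≤ 0 := by
    rw [← inner_self_eq_norm_sq (𝕜 := ℂ)]
    simpa [ContinuousLinearMap.star_eq_adjoint, ContinuousLinearMap.adjoint_inner_left] using h1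
  have h3 : S (P x) = 0 := by simpa using le_antisymm h2 (sq_nonneg _)
  simp [h3]

namespace OperatorMean

variable (Λ : OperatorMean H)

theorem map_zero_zero : Λ.toFun 0 0 = 0 := by
  have h0 := Λ.nonneg 0 0 le_rfl le_rfl
  have h2 : (0 : H →L[ℂ] H) ≤ 1 + 1 := add_nonneg zero_le_one zero_le_one
  -- Conjugation by 2 gives 4Λ(0,0) ≤ Λ(0,0), which forces Λ(0,0) ≤ 0.
  have h := Λ.transformer 0 0 (1 + 1) le_rfl le_rfl h2
  simp only [ContinuousLinearMap.zero_comp, ContinuousLinearMap.comp_zero] at h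
  have h3 : (1 + 1) ∘L Λ.toFun 0 0 ∘L (1 + 1) =
      Λ.toFun 0 0 + (Λ.toFun 0 0 + Λ.toFun 0 0 + Λ.toFun 0 0) := by
    ext x; simp; abel
  rw [h3, add_le_iff_nonpos_right] at h
  refine le_antisymm (le_trans ?_ h) h0
  rw [add_assoc]
  exact le_add_of_nonneg_right (add_nonneg h0 h0)

/-- The transformer inequality holds for `T`. -/
def Transforms (T : H →L[ℂ] H) : Prop :=
  ∀ A B, 0 ≤ A → 0 ≤ B → T ∘L Λ.toFun A B ∘L T† ≤ Λ.toFun (T ∘L A ∘L T†) (T ∘L B ∘L T†)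

theorem Transforms.of_nonneg {T : H →L[ℂ] H} (hT : 0 ≤ T) : Λ.Transforms T := by
  intro A B hA hB
  rw [adjoint_eq_of_nonneg hT]
  exact Λ.transformer A B T hA hB hT

variable {Λ} in
theorem Transforms.comp {S T : H →L[ℂ] H} (hS : Λ.Transforms S) (hT : Λ.Transforms T) :
    Λ.Transforms (S ∘L T) := by
  intro A B hA hB
  have h1 := conj_mono (hT A B hA hB) S
  have h2 := hS _ _ (conj_nonneg hA T) (conj_nonneg hB T)
  simpa only [ContinuousLinearMap.adjoint_comp, ContinuousLinearMap.comp_assoc] using h1.trans h2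

/-- Operator means are local: they commute with reducing projections. -/
theorem comp_of_reducing {V : E →L[ℂ] H} (hV : ∀ x, (V†) (V x) = x) {A B A' B' : H →L[ℂ] H}
    (hA' : 0 ≤ A') (hB' : 0 ≤ B') (hA : A' ≤ A) (hB : B' ≤ B)
    (hVA : (V ∘L V†) ∘L A ∘L (V ∘L V†) = A') (hVB : (V ∘L V†) ∘L B ∘L (V ∘L V†) = B') :
    Λ.toFun A B ∘L V = Λ.toFun A' B' ∘L V := by
  -- Monotonicity makes D = Λ(A,B) - Λ(A',B') positive, while the transformer inequality for the
  -- projection VV† makes its compression by V nonpositive; hence DV = 0.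
  have h1 := Λ.mono _ _ _ _ hA' hB' (hA'.trans hA) (hB'.trans hB) hA hB
  have h2 := Λ.transformer A B _ (hA'.trans hA) (hB'.trans hB) (comp_adjoint_self_nonneg V)
  rw [hVA, hVB] at h2
  rw [← sub_eq_zero, ← ContinuousLinearMap.sub_comp]
  refine comp_eq_zero_of_conj_nonpos (sub_nonneg.2 h1) ?_
  have h3 := conj_mono h2 (V†)
  rw [ContinuousLinearMap.adjoint_adjoint] at h3
  rw [← sub_nonpos] at h3
  convert h3 using 1
  ext x; simp [hV]

end OperatorMean

end OperatorMeans

/-! ### Two orthogonal copies of E in H: superadditivity, homogeneity, normalization -/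

section OrthogonalEmbeddings

variable {H : Type*} [NormedAddCommGroup H] [InnerProductSpace ℂ H] [CompleteSpace H]
variable {E : Type*} [NormedAddCommGroup E] [InnerProductSpace ℂ E] [CompleteSpace E]

/-- `V` and `W` are isometries with orthogonal ranges. -/
structure IsOrthogonalPair (V W : E →L[ℂ] H) : Prop where
  left : ∀ x, (V†) (V x) = x
  right : ∀ x, (W†) (W x) = x
  left_right : ∀ x, (V†) (W x) = 0
  right_left : ∀ x, (W†) (V x) = 0

theorem IsOrthogonalPair.symm {V W : E →L[ℂ] H} (h : IsOrthogonalPair V W) :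
    IsOrthogonalPair W V :=
  ⟨h.right, h.left, h.right_left, h.left_right⟩

/-- The mean of operators on `E`, moved to `H` by `V` and compressed back. -/
noncomputable abbrev OperatorMean.compress (Λ : OperatorMean H) (V : E →L[ℂ] H) (A B : E →L[ℂ] E) : E →L[ℂ] E :=
  (V†) ∘L Λ.toFun (V ∘L A ∘L V†) (V ∘L B ∘L V†) ∘L V

namespace OperatorMean

variable (Λ : OperatorMean H) {V W : E →L[ℂ] H} {A B C D : E →L[ℂ] E}

/-- For isometries `V`, `W` with orthogonal ranges, `V (V + W)†` is a product of two positive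
operators, so that it satisfies the transformer inequality. -/
theorem transforms_fold (h : IsOrthogonalPair V W) : Λ.Transforms (V ∘L (V + W)†) := by
  obtain ⟨hV, hW, hVW, hWV⟩ := h
  have h1 : 0 ≤ (V + W) ∘L (V + W)† := comp_adjoint_self_nonneg _
  -- This factor maps V + W to V, since (V - W)†(V + W) = 0 and V†(V + W) = 1.
  have h2 : 0 ≤ (V - W) ∘L (V - W)† + V ∘L V† :=
    add_nonneg (comp_adjoint_self_nonneg _) (comp_adjoint_self_nonneg _)
  convert (Transforms.of_nonneg Λ h2).comp (Transforms.of_nonneg Λ h1) using 1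
  ext x
  simp [hV, hW, hVW, hWV]

/-- Locality on the range of W, where both arguments vanish, combined with Λ(0,0) = 0. -/
theorem toFun_comp_orthogonal (h : IsOrthogonalPair V W) (hA : 0 ≤ A) (hB : 0 ≤ B) :
    Λ.toFun (V ∘L A ∘L V†) (V ∘L B ∘L V†) ∘L W = 0 := by
  have h := Λ.comp_of_reducing h.right (A' := 0) (B' := 0) le_rfl le_rfl
    (conj_nonneg hA V) (conj_nonneg hB V)
    (by ext x; simp [h.left_right]) (by ext x; simp [h.left_right])
  rwa [Λ.map_zero_zero, ContinuousLinearMap.zero_comp] at h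

theorem adjoint_comp_toFun_orthogonal (h : IsOrthogonalPair V W) (hA : 0 ≤ A) (hB : 0 ≤ B) :
    (W†) ∘L Λ.toFun (V ∘L A ∘L V†) (V ∘L B ∘L V†) = 0 := by
  have h0 := congr(($(Λ.toFun_comp_orthogonal h hA hB))†)
  rwa [ContinuousLinearMap.adjoint_comp, map_zero,
    adjoint_eq_of_nonneg (Λ.nonneg _ _ (conj_nonneg hA _) (conj_nonneg hB _))] at h0

/-- The fold W(W + V)† carries the copy on V to the copy on W. This lets the second summand in
`compress_add_le` live on W. -/
theorem compress_le_of_orthogonal (h : IsOrthogonalPair V W) (hA : 0 ≤ A) (hB : 0 ≤ B) :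
    Λ.compress V A B ≤ Λ.compress W A B := by
  have h0 := ContinuousLinearMap.ext_iff.1 (Λ.toFun_comp_orthogonal h hA hB)
  have h00 := ContinuousLinearMap.ext_iff.1 (Λ.adjoint_comp_toFun_orthogonal h hA hB)
  have hT := Λ.transforms_fold h.symm _ _ (conj_nonneg hA V) (conj_nonneg hB V)
  obtain ⟨hV, hW, hVW, hWV⟩ := h
  have e : ∀ A : E →L[ℂ] E, (W ∘L (W + V)†) ∘L (V ∘L A ∘L V†) ∘L (W ∘L (W + V)†)† =
      W ∘L A ∘L W† := by
    intro A; ext x; simp [hV, hVW, hWV, ContinuousLinearMap.adjoint_comp]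
  rw [e, e] at hT
  have h := conj_mono hT (W†)
  rw [ContinuousLinearMap.adjoint_adjoint] at h
  convert h using 1
  ext x
  simp only [ContinuousLinearMap.coe_comp, Function.comp_apply, _root_.zero_apply] at h0 h00
  simp [hW, h0, h00, ContinuousLinearMap.adjoint_comp]

/-- By locality, the mean of A ⊕ C and B ⊕ D, with blocks on V and W, is the direct sum of the
means. Folding W onto V adds the two blocks, both inside and outside Λ. -/
theorem compress_add_le (h : IsOrthogonalPair V W)
    (hA : 0 ≤ A) (hB : 0 ≤ B) (hC : 0 ≤ C) (hD : 0 ≤ D) :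
    Λ.compress V A B + Λ.compress V C D ≤ Λ.compress V (A + C) (B + D) := by
  refine (add_le_add_right (Λ.compress_le_of_orthogonal h hC hD) _).trans ?_
  have a0 := conj_nonneg hA V
  have b0 := conj_nonneg hB V
  have c0 := conj_nonneg hC W
  have d0 := conj_nonneg hD W
  have hT := Λ.transforms_fold h _ _ (add_nonneg a0 c0) (add_nonneg b0 d0)
  have h1 := ContinuousLinearMap.ext_iff.1 (Λ.adjoint_comp_toFun_orthogonal h hA hB)
  have h2 := ContinuousLinearMap.ext_iff.1 (Λ.adjoint_comp_toFun_orthogonal h.symm hC hD)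
  obtain ⟨hV, hW, hVW, hWV⟩ := h
  have hMV := ContinuousLinearMap.ext_iff.1 <| Λ.comp_of_reducing hV a0 b0
    (le_add_of_nonneg_right c0) (le_add_of_nonneg_right d0)
    (by ext x; simp [hV, hVW]) (by ext x; simp [hV, hVW])
  have hMW := ContinuousLinearMap.ext_iff.1 <| Λ.comp_of_reducing hW c0 d0
    (le_add_of_nonneg_left a0) (le_add_of_nonneg_left b0)
    (by ext x; simp [hW, hWV]) (by ext x; simp [hW, hWV])
  have e : ∀ A C : E →L[ℂ] E, (V ∘L (V + W)†) ∘L (V ∘L A ∘L V† + W ∘L C ∘L W†) ∘L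
      (V ∘L (V + W)†)† = V ∘L (A + C) ∘L V† := by
    intro A C; ext x; simp [hV, hW, hVW, hWV, ContinuousLinearMap.adjoint_comp]
  rw [e, e] at hT
  have h := conj_mono hT (V†)
  rw [ContinuousLinearMap.adjoint_adjoint] at h
  convert h using 1
  ext x
  simp only [ContinuousLinearMap.coe_comp, Function.comp_apply, _root_.zero_apply]
    at hMV hMW h1 h2
  simp [hV, hMV, hMW, h1, h2, ContinuousLinearMap.adjoint_comp]

/-- The transformer inequality for the scalar operator √c. -/
theorem smul_compress_le (hA : 0 ≤ A) (hB : 0 ≤ B) {c : ℝ} (hc : 0 ≤ c) :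
    c • Λ.compress V A B ≤ Λ.compress V (c • A) (c • B) := by
  have h0 : 0 ≤ Real.sqrt c • (1 : H →L[ℂ] H) := smul_nonneg (Real.sqrt_nonneg c) zero_le_one
  have h := conj_mono (Λ.transformer _ _ _ (conj_nonneg hA V) (conj_nonneg hB V) h0) (V†)
  rw [ContinuousLinearMap.adjoint_adjoint] at h
  have hs : ∀ x : E, Real.sqrt c • Real.sqrt c • x = c • x := fun x => by
    rw [smul_smul, Real.mul_self_sqrt hc]
  have hs' : ∀ x : H, Real.sqrt c • Real.sqrt c • x = c • x := fun x => by
    rw [smul_smul, Real.mul_self_sqrt hc]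
  have e : ∀ A : E →L[ℂ] E, (Real.sqrt c • (1 : H →L[ℂ] H)) ∘L (V ∘L A ∘L V†) ∘L
      (Real.sqrt c • (1 : H →L[ℂ] H)) = V ∘L (c • A) ∘L V† := by
    intro A; ext x; simp [hs']
  rw [e, e] at h
  convert h using 1
  ext x; simp [hs]

theorem one_le_compress_one (hV : ∀ x, (V†) (V x) = x) : 1 ≤ Λ.compress V 1 1 := by
  have h := Λ.transformer 1 1 _ zero_le_one zero_le_one (comp_adjoint_self_nonneg V)
  rw [show Λ.toFun 1 1 = 1 from Λ.map_id] at h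
  have e : (V ∘L V†) ∘L 1 ∘L (V ∘L V†) = V ∘L 1 ∘L V† := by ext x; simp [hV]
  rw [e] at h
  have h := conj_mono h (V†)
  rw [ContinuousLinearMap.adjoint_adjoint] at h
  convert h using 1
  ext x; simp [hV]

end OperatorMean

/-- An infinite-dimensional space has room for a second copy of a finite-dimensional subspace. -/
theorem exists_isOrthogonalPair [FiniteDimensional ℂ E] (hH : ¬ FiniteDimensional ℂ H)
    (V : E →ₗᵢ[ℂ] H) : ∃ W : E →L[ℂ] H, IsOrthogonalPair V.toContinuousLinearMap W := by
  set K := V.toLinearMap.range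
  have hK : ¬ FiniteDimensional ℂ Kᗮ := by
    intro h
    apply hH
    have h1 : FiniteDimensional ℂ (K ⊔ Kᗮ : Submodule ℂ H) := inferInstance
    rw [Submodule.sup_orthogonal_of_hasOrthogonalProjection] at h1
    exact Module.Finite.equiv (Submodule.topEquiv : (⊤ : Submodule ℂ H) ≃ₗ[ℂ] H)
  have hr : (Module.finrank ℂ E : Cardinal) ≤ Module.rank ℂ Kᗮ := by
    refine le_trans (Cardinal.natCast_lt_aleph0).le ?_
    rw [← not_lt]
    rwa [Module.rank_lt_aleph0_iff]
  obtain ⟨f, hf⟩ := Module.le_rank_iff_exists_linearMap.1 hr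
  have hrank : Module.finrank ℂ f.range = Module.finrank ℂ E := by
    rw [LinearMap.finrank_range_of_inj hf]; simp
  -- The injection f need not be isometric; only its range is kept, and orthonormal bases identify E
  -- with it.
  let g : E ≃ₗᵢ[ℂ] f.range := (stdOrthonormalBasis ℂ E).repr.trans
    ((stdOrthonormalBasis ℂ f.range).reindex (finCongr hrank)).repr.symm
  let W : E →ₗᵢ[ℂ] H := Kᗮ.subtypeₗᵢ.comp (f.range.subtypeₗᵢ.comp g.toLinearIsometry)
  have ho : ∀ x y, inner ℂ (V x) (W y) = 0 := fun x y =>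
    (Submodule.mem_orthogonal _ _).1 (f.range.subtypeₗᵢ.comp g.toLinearIsometry y).2 _ ⟨x, rfl⟩
  refine ⟨W.toContinuousLinearMap, fun x => congr($(V.adjoint_comp_self) x),
    fun x => congr($(W.adjoint_comp_self) x), fun x => ?_, fun x => ?_⟩
  · refine ext_inner_left ℂ fun y => ?_
    rw [ContinuousLinearMap.adjoint_inner_right, inner_zero_right]
    exact ho y x
  · refine ext_inner_right ℂ fun y => ?_
    rw [ContinuousLinearMap.adjoint_inner_left, inner_zero_left]
    exact ho x y

end OrthogonalEmbeddings

/-! ### The normalized trace -/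

section Trace

variable {d : ℕ}

@[simp] theorem ntr_add (a b : Mat d) : ntr (a + b) = ntr a + ntr b := by
  simp [ntr, mul_add]

@[simp] theorem ntr_sub (a b : Mat d) : ntr (a - b) = ntr a - ntr b := by
  simp [ntr, mul_sub]

@[simp] theorem ntr_smul (c : ℂ) (a : Mat d) : ntr (c • a) = c * ntr a := by
  simp only [ntr, Matrix.trace_smul, smul_eq_mul]; ring

@[simp] theorem ntr_real_smul (c : ℝ) (a : Mat d) : ntr (c • a) = c * ntr a := by
  simp only [ntr, Matrix.trace_smul, Complex.real_smul]; ring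

@[simp] theorem ntr_conjTranspose (a : Mat d) : ntr aᴴ = star (ntr a) := by
  simp [ntr, Matrix.trace_conjTranspose]

theorem ntr_one (hd : 0 < d) : ntr (1 : Mat d) = 1 := by
  have : (d : ℂ) ≠ 0 := by exact_mod_cast hd.ne'
  simp [ntr, this]

theorem ntr_mul_comm (a b : Mat d) : ntr (a * b) = ntr (b * a) := by
  rw [ntr, ntr, Matrix.trace_mul_comm]

/-- Each eigenvalue of a positive matrix is at most the sum of all of them. -/
theorem posSemidef_trace_smul_one_sub {n : Type*} [Fintype n] [DecidableEq n] {A : Matrix n n ℂ}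
    (hA : A.PosSemidef) : (A.trace • (1 : Matrix n n ℂ) - A).PosSemidef := by
  have h1 : (diagonal fun i => ((∑ j, hA.1.eigenvalues j - hA.1.eigenvalues i : ℝ) : ℂ)).PosSemidef := by
    rw [Matrix.posSemidef_diagonal_iff]
    intro i
    rw [Complex.zero_le_real, sub_nonneg]
    exact Finset.single_le_sum (fun j _ => hA.eigenvalues_nonneg j) (Finset.mem_univ i)
  have h2 := h1.mul_mul_conjTranspose_same (hA.1.eigenvectorUnitary : Matrix n n ℂ)
  convert h2 using 1
  have h3 : (diagonal fun i => ((∑ j, hA.1.eigenvalues j - hA.1.eigenvalues i : ℝ) : ℂ)) =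
      A.trace • (1 : Matrix n n ℂ) - diagonal fun i => ((hA.1.eigenvalues i : ℝ) : ℂ) := by
    rw [hA.1.trace_eq_sum_eigenvalues, smul_one_eq_diagonal, diagonal_sub]
    simp
  have h4 := hA.1.spectral_theorem
  have h5 : (hA.1.eigenvectorUnitary : Matrix n n ℂ) * (hA.1.eigenvectorUnitary : Matrix n n ℂ)ᴴ = 1 :=
    Unitary.coe_mul_star_self _
  rw [Unitary.conjStarAlgAut_apply] at h4
  rw [h3, Matrix.mul_sub, Matrix.sub_mul, Matrix.mul_smul, Matrix.smul_mul, Matrix.mul_one, h5]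
  exact congrArg _ h4

open scoped MatrixOrder in
theorem trace_mul_self_le {n : Type*} [Fintype n] [DecidableEq n] {A : Matrix n n ℂ}
    (hA : A.PosSemidef) : (A * A).trace ≤ A.trace * A.trace := by
  obtain ⟨S, rfl : A = Sᴴ * S⟩ := CStarAlgebra.nonneg_iff_eq_star_mul_self.1 hA.nonneg
  have h := ((posSemidef_trace_smul_one_sub hA).mul_mul_conjTranspose_same S).trace_nonneg
  rw [← sub_nonneg]
  convert h using 1
  rw [Matrix.mul_sub, Matrix.sub_mul, Matrix.trace_sub, Matrix.mul_smul, Matrix.smul_mul,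
    Matrix.trace_smul, Matrix.mul_one, Matrix.trace_mul_comm S Sᴴ, smul_eq_mul,
    Matrix.trace_mul_comm (Sᴴ * S) (Sᴴ * S), Matrix.trace_mul_comm _ Sᴴ]
  simp only [Matrix.mul_assoc]

/-! ### The generator of the depolarizing semigroup -/

/-- The operator `a ↦ a - τ(a) 1`. -/
noncomputable def centering (d : ℕ) : Mat d →ₗ[ℂ] Mat d where
  toFun a := a - ntr a • 1
  map_add' a b := by simp only [ntr_add]; module
  map_smul' c a := by simp only [ntr_smul, RingHom.id_apply]; module

theorem centering_apply (a : Mat d) : centering d a = a - ntr a • 1 := rfl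

theorem ntr_centering (hd : 0 < d) (a : Mat d) : ntr (centering d a) = 0 := by
  simp [centering_apply, ntr_one hd]

theorem centering_centering (hd : 0 < d) (a : Mat d) :
    centering d (centering d a) = centering d a := by
  rw [centering_apply (centering d a), ntr_centering hd, zero_smul, sub_zero]

theorem depolarizing_apply (t : ℝ) (a : Mat d) : depolarizing d t a =
    Real.exp (-t) • a + ((1 - Real.exp (-t) : ℝ) * ntr a) • (1 : Mat d) := rfl

theorem depolarizing_eq (t : ℝ) (a : Mat d) :
    depolarizing d t a = a - (1 - Real.exp (-t)) • centering d a := by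
  rw [depolarizing_apply, centering_apply]
  simp only [← Complex.coe_smul]
  push_cast
  module

theorem depolarizing_isGenerator : IsGenerator (depolarizing d) (centering d) := by
  intro x
  have h : HasDerivAt (fun t : ℝ => 1 - Real.exp (-t)) 1 0 := by
    have := ((hasDerivAt_neg (0 : ℝ)).exp).const_sub 1
    simpa using this
  have h2 := (hasDerivAt_iff_tendsto_slope_zero.1 h).mono_left
    (nhdsWithin_mono 0 (fun t (ht : 0 < t) => ht.ne'))
  have h3 := h2.smul_const (centering d x)
  rw [one_smul] at h3
  refine h3.congr fun t => ?_
  simp [depolarizing_eq, smul_smul]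

theorem IsGenerator.unique {P : ℝ → Mat d →ₗ[ℂ] Mat d} {L M : Mat d →ₗ[ℂ] Mat d}
    (hL : IsGenerator P L) (hM : IsGenerator P M) : L = M :=
  LinearMap.ext fun x => tendsto_nhds_unique (hL x) (hM x)

theorem depolarizing_isTraciallySymmetric : IsTraciallySymmetric (depolarizing d) := by
  intro t _ x y
  simp only [depolarizing_apply, add_mul, mul_add, smul_mul_assoc, mul_smul_comm, one_mul, mul_one,
    ntr_add, ntr_smul, ntr_real_smul]
  ring

theorem depolarizing_isCompletelyPositive {t : ℝ} (ht : 0 ≤ t) :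
    IsCompletelyPositive (depolarizing d t) := by
  intro n X hX
  have hc : 0 ≤ 1 - Real.exp (-t) := by
    rw [sub_nonneg, Real.exp_le_one_iff]; linarith
  -- This sum of principal submatrices is the matrix of block traces; its Kronecker product with 1
  -- amplifies a ↦ tr(a)1.
  have h1 : (∑ r : Fin d, (Matrix.comp (Fin n) (Fin n) (Fin d) (Fin d) ℂ X).submatrix
      (fun i => (i, r)) (fun i => (i, r))).PosSemidef :=
    Matrix.posSemidef_sum _ fun r _ => hX.submatrix _
  have h2 := (h1.kronecker (Matrix.PosSemidef.one (n := Fin d) (R := ℂ))).smul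
    (show (0 : ℝ) ≤ (1 - Real.exp (-t)) * (d : ℝ)⁻¹ by positivity)
  have h3 := (hX.smul (Real.exp_pos (-t)).le).add h2
  convert h3 using 1
  ext ⟨i, p⟩ ⟨j, q⟩
  by_cases hpq : p = q
  · simp [depolarizing_apply, Matrix.sum_apply, ntr, Matrix.trace, hpq, mul_assoc]
  · simp [depolarizing_apply, Matrix.sum_apply, ntr, Matrix.trace, hpq]

theorem depolarizing_isQuantumMarkovSemigroup (hd : 0 < d) :
    IsQuantumMarkovSemigroup (depolarizing d) where
  zero := by ext1 x; simp [depolarizing_apply]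
  add s t _ _ := by
    ext1 x
    rw [LinearMap.comp_apply, depolarizing_eq, depolarizing_eq s, depolarizing_eq t, map_sub,
      LinearMap.map_smul_of_tower, centering_centering hd, neg_add, Real.exp_add]
    module
  completelyPositive t ht := depolarizing_isCompletelyPositive ht
  unital t _ := by
    rw [depolarizing_eq, centering_apply, ntr_one hd]; simp
  continuous x := by
    simp only [depolarizing_eq]
    fun_prop

theorem exists_isLindbladForm_depolarizing (hd : 0 < d) :
    ∃ (n : ℕ) (v : Fin n → Mat d), IsLindbladForm (depolarizing d) v := by
  -- For v = cE_ij the terms c²(E_jj a + a E_ii) sum to 2dc²a = a over all pairs, which fixes c² =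
  -- 1/(2d); the cross terms then sum to τ(a)1.
  let c : ℝ := (Real.sqrt (2 * d))⁻¹
  have hd' : (d : ℂ) ≠ 0 := by exact_mod_cast hd.ne'
  have hc : ((c : ℝ) : ℂ) * c = (2 * d : ℂ)⁻¹ := by
    rw [← Complex.ofReal_mul, ← mul_inv, Real.mul_self_sqrt (by positivity)]
    push_cast; rfl
  let w : Fin d × Fin d → Mat d := fun p => Matrix.single p.1 p.2 (c : ℂ)
  have hw : ∀ p, (w p)ᴴ = w p.swap := fun p => by simp [w]
  refine ⟨d * d, w ∘ finProdFinEquiv.symm, ?_, ?_⟩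
  · have h1 : (fun j => ((w ∘ finProdFinEquiv.symm) j)ᴴ) =
        (w ∘ (Equiv.prodComm (Fin d) (Fin d))) ∘ finProdFinEquiv.symm := by
      funext j; exact hw _
    rw [h1, EquivLike.range_comp, EquivLike.range_comp, EquivLike.range_comp]
  · convert depolarizing_isGenerator (d := d) using 1
    ext1 a
    rw [lindblad, LinearMap.sum_apply, centering_apply]
    have h1 : ∀ i j, (partialDeriv (w (i, j))ᴴ ∘ₗ partialDeriv (w (i, j))) a =
        single j j (2 * d : ℂ)⁻¹ * a - single j j ((2 * d : ℂ)⁻¹ * a i i) -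
          single i i ((2 * d : ℂ)⁻¹ * a j j) + a * single i i (2 * d : ℂ)⁻¹ := by
      intro i j
      have e : (w (i, j))ᴴ = single j i (c : ℂ) := hw (i, j)
      have e' : w (i, j) = single i j (c : ℂ) := rfl
      rw [e, e']
      simp only [partialDeriv, LinearMap.comp_apply, LinearMap.sub_apply,
        LinearMap.mulLeft_apply, LinearMap.mulRight_apply, mul_sub, sub_mul,
        ← hc, ← mul_assoc, single_mul_single_same, single_mul_mul_single]
      rw [mul_assoc a, single_mul_single_same, mul_right_comm _ (a i i),
        mul_right_comm _ (a j j)]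
      abel
    have h2 : ∀ x : ℂ, ∑ j : Fin d, single j j x = x • (1 : Mat d) := fun x => by
      rw [smul_one_eq_diagonal, ← Matrix.sum_single_eq_diagonal]
    have h3 : ∑ i : Fin d, ∑ j : Fin d, single j j ((2 * d : ℂ)⁻¹ * a i i) = ((2 * d : ℂ)⁻¹ * a.trace) • (1 : Mat d) := by
      simp only [h2, ← Finset.sum_smul, ← Finset.mul_sum]; rfl
    have h4 : ∑ i : Fin d, ∑ j : Fin d, single i i ((2 * d : ℂ)⁻¹ * a j j) = ((2 * d : ℂ)⁻¹ * a.trace) • (1 : Mat d) := by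
      rw [Finset.sum_comm, h3]
    have h5 : ∑ _i : Fin d, ∑ j : Fin d, single j j (2 * d : ℂ)⁻¹ * a = (2 : ℂ)⁻¹ • a := by
      simp only [← Finset.sum_mul, h2, Finset.sum_const, Finset.card_univ, Fintype.card_fin]
      rw [smul_mul_assoc, smul_one_mul, ← Nat.cast_smul_eq_nsmul ℂ, smul_smul]
      congr 1; field_simp
    have h6 : ∑ i : Fin d, ∑ _j : Fin d, a * single i i (2 * d : ℂ)⁻¹ = (2 : ℂ)⁻¹ • a := by
      rw [Finset.sum_comm]
      simp only [← Finset.mul_sum, h2, Finset.sum_const, Finset.card_univ, Fintype.card_fin]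
      rw [mul_smul_comm, mul_smul_one, ← Nat.cast_smul_eq_nsmul ℂ, smul_smul]
      congr 1; field_simp
    refine (Equiv.sum_comp finProdFinEquiv.symm
      (fun p => (partialDeriv (w p)ᴴ ∘ₗ partialDeriv (w p)) a)).trans ?_
    rw [Fintype.sum_prod_type]
    simp only [h1, Finset.sum_add_distrib, Finset.sum_sub_distrib, h3, h4, h5, h6, ntr]
    rw [mul_inv]
    module

/-! ### The Bakry–Émery condition -/

/-- Only the centered parts of a and b enter Γ, so that Γ₂(a,a) becomes a combination of y =
(La)*(La) and τ(y)1. -/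
theorem gam_centering (hd : 0 < d) (a b : Mat d) : Gam (centering d) a b = (1 / 2 : ℝ) •
    ((centering d a)ᴴ * centering d b + ntr ((centering d a)ᴴ * centering d b) • 1) := by
  have h : ntr ((centering d a)ᴴ * centering d b) = ntr (aᴴ * b) - star (ntr a) * ntr b := by
    simp only [centering_apply, conjTranspose_sub, conjTranspose_smul, conjTranspose_one, mul_sub,
      sub_mul, mul_smul_comm, smul_mul_assoc, one_mul, mul_one, ntr_sub, ntr_smul, ntr_one hd,
      ntr_conjTranspose]
    ring
  rw [Gam, h]
  congr 1
  simp only [centering_apply, conjTranspose_sub, conjTranspose_smul, conjTranspose_one, mul_sub,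
    sub_mul, mul_smul_comm, smul_mul_assoc, one_mul, mul_one]
  module

theorem depolarizing_satisfiesBE (hd : 0 < d) :
    SatisfiesBE (depolarizing d) (1 / 2) (2 * d) := by
  refine ⟨depolarizing_isQuantumMarkovSemigroup hd, centering d, depolarizing_isGenerator, ?_⟩
  intro a
  have hd' : (d : ℂ) ≠ 0 := by exact_mod_cast hd.ne'
  have hG : Gam (centering d) a (centering d a) = Gam (centering d) a a := by
    simp only [gam_centering hd, centering_centering hd]
  have hG' : Gam (centering d) (centering d a) a = Gam (centering d) a a := by
    simp only [gam_centering hd, centering_centering hd]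
  rw [Gam2, hG, hG', gam_centering hd, centering_apply (_ • _)]
  set y := (centering d a)ᴴ * centering d a with hy
  -- Here Γ₂ = y/4 + 3τ(y)/4 and Γ/2 = (y + τ(y))/4, so what remains is τ(y)/2 - y/(2d).
  have h := (posSemidef_trace_smul_one_sub
    (posSemidef_conjTranspose_mul_self (centering d a))).smul
    (show (0 : ℝ) ≤ 1 / (2 * d) by positivity)
  convert h using 1
  rw [← hy, show y.trace = d * ntr y by rw [ntr, mul_inv_cancel_left₀ hd']]
  simp only [ntr_add, ntr_smul, ntr_one hd, ← Complex.coe_smul]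
  push_cast
  match_scalars <;> field_simp <;> ring

end Trace

/-! ### The gradient estimate -/

section GradientEstimate

variable {d : ℕ}

theorem ntr_sum {ι : Type*} (s : Finset ι) (f : ι → Mat d) :
    ntr (∑ i ∈ s, f i) = ∑ i ∈ s, ntr (f i) := by
  simp only [ntr, Matrix.trace_sum, Finset.mul_sum]

theorem onL2_toL2 (T : Mat d →ₗ[ℂ] Mat d) (a : Mat d) : onL2 T (toL2 d a) = toL2 d (T a) := by
  simp [onL2, ofL2_toL2]

theorem onL2_nonneg {T : Mat d →ₗ[ℂ] Mat d} (h : ∀ a, 0 ≤ ip (T a) a) : 0 ≤ onL2 T := by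
  rw [ContinuousLinearMap.nonneg_iff_isPositive, ContinuousLinearMap.isPositive_iff_complex]
  intro ξ
  obtain ⟨a, rfl⟩ : ∃ a, toL2 d a = ξ := ⟨ofL2 d ξ, toL2_ofL2 ξ⟩
  rw [onL2_toL2, inner_toL2]
  have h := Complex.le_def.1 (h a)
  refine ⟨?_, by simpa using h.1⟩
  apply Complex.ext <;> simp [← h.2]

theorem ntr_nonneg {a : Mat d} (ha : a.PosSemidef) : 0 ≤ ntr a := by
  refine mul_nonneg ?_ ha.trace_nonneg
  rw [← Complex.ofReal_natCast, ← Complex.ofReal_inv, Complex.zero_le_real]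
  positivity

theorem onL2_mulLeft_nonneg {ρ : Mat d} (hρ : ρ.PosSemidef) :
    0 ≤ onL2 (LinearMap.mulLeft ℂ ρ) := by
  refine onL2_nonneg fun a => ?_
  rw [LinearMap.mulLeft_apply, ip, conjTranspose_mul, hρ.1.eq]
  exact ntr_nonneg (hρ.conjTranspose_mul_mul_same a)

theorem onL2_mulRight_nonneg {ρ : Mat d} (hρ : ρ.PosSemidef) :
    0 ≤ onL2 (LinearMap.mulRight ℂ ρ) := by
  refine onL2_nonneg fun a => ?_
  rw [LinearMap.mulRight_apply, ip, conjTranspose_mul, hρ.1.eq, mul_assoc, ntr_mul_comm, mul_assoc,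
    ntr_mul_comm]
  exact ntr_nonneg (hρ.mul_mul_conjTranspose_same a)

theorem onL2_mulLeft_comb (r s : ℝ) (ρ : Mat d) : onL2 (LinearMap.mulLeft ℂ (r • ρ + s • 1)) =
    r • onL2 (LinearMap.mulLeft ℂ ρ) + s • 1 := by
  ext1 ξ
  obtain ⟨a, rfl⟩ : ∃ a, toL2 d a = ξ := ⟨ofL2 d ξ, toL2_ofL2 ξ⟩
  simp [onL2_toL2, add_mul, LinearMap.map_smul_of_tower]

theorem onL2_mulRight_comb (r s : ℝ) (ρ : Mat d) : onL2 (LinearMap.mulRight ℂ (r • ρ + s • 1)) =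
    r • onL2 (LinearMap.mulRight ℂ ρ) + s • 1 := by
  ext1 ξ
  obtain ⟨a, rfl⟩ : ∃ a, toL2 d a = ξ := ⟨ofL2 d ξ, toL2_ofL2 ξ⟩
  simp [onL2_toL2, mul_add, LinearMap.map_smul_of_tower]

variable {H : Type*} [NormedAddCommGroup H] [InnerProductSpace ℂ H] [CompleteSpace H]

theorem ip_hat (Λ : OperatorMean H) (V : L2 d →ₗᵢ[ℂ] H) (ρ a b : Mat d) :
    ip (hat Λ V ρ a) b = inner ℂ (Λ.compress V.toContinuousLinearMap
      (onL2 (LinearMap.mulLeft ℂ ρ)) (onL2 (LinearMap.mulRight ℂ ρ)) (toL2 d a)) (toL2 d b) := by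
  rw [← inner_toL2, hat, LinearMap.comp_apply, LinearMap.comp_apply, toL2_ofL2]
  rfl

/-- Concavity and normalization of the operator mean, on the segment from `ρ` to the identity. -/
theorem ip_hat_comb_ge (hH : ¬ FiniteDimensional ℂ H) (Λ : OperatorMean H) (V : L2 d →ₗᵢ[ℂ] H)
    {ρ : Mat d} (hρ : ρ.PosSemidef) {r s : ℝ} (hr : 0 ≤ r) (hs : 0 ≤ s) (a : Mat d) :
    r * (ip (hat Λ V ρ a) a).re + s * (ip a a).re ≤ (ip (hat Λ V (r • ρ + s • 1) a) a).re := by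
  obtain ⟨W, hW⟩ := exists_isOrthogonalPair hH V
  have hl := onL2_mulLeft_nonneg hρ
  have hr' := onL2_mulRight_nonneg hρ
  have h1 : (0 : L2 d →L[ℂ] L2 d) ≤ 1 := zero_le_one
  -- The scalars move inside the mean and 1 ≤ Λ(1,1) is used before superadditivity merges the two
  -- terms.
  have h := (add_le_add (Λ.smul_compress_le (V := V.toContinuousLinearMap) hl hr' hr)
    ((smul_le_smul_of_nonneg_left (Λ.one_le_compress_one hW.left) hs).trans
      (Λ.smul_compress_le h1 h1 hs))).trans
    (Λ.compress_add_le hW (smul_nonneg hr hl) (smul_nonneg hr hr') (smul_nonneg hs h1)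
      (smul_nonneg hs h1))
  have h := ((ContinuousLinearMap.le_def _ _).1 h).re_inner_nonneg_left (toL2 d a)
  rw [← onL2_mulLeft_comb, ← onL2_mulRight_comb] at h
  simp only [_root_.sub_apply, _root_.add_apply, _root_.smul_apply, inner_sub_left,
    inner_add_left, map_sub, map_add, ← Complex.coe_smul, inner_smul_left, Complex.conj_ofReal,
    ← ip_hat, one_apply_eq_self, inner_toL2, sub_nonneg, RCLike.re_to_complex,
    Complex.re_ofReal_mul] at h
  exact h

/-- Cyclicity of the trace makes [v*, ·] the adjoint of [v, ·]. -/
theorem ip_partialDeriv (v a : Mat d) :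
    ip (partialDeriv v a) (partialDeriv v a) = ip a ((partialDeriv vᴴ ∘ₗ partialDeriv v) a) := by
  rw [LinearMap.comp_apply]
  generalize hy : partialDeriv v a = y
  rw [ip, ← hy, ip]
  simp only [partialDeriv, LinearMap.sub_apply, LinearMap.mulLeft_apply,
    LinearMap.mulRight_apply, conjTranspose_sub, conjTranspose_mul, sub_mul (aᴴ * vᴴ), mul_sub aᴴ,
    ntr_sub, mul_assoc]
  rw [ntr_mul_comm vᴴ, ← mul_sub, mul_assoc]

theorem ip_centering (hd : 0 < d) (a b : Mat d) :
    ip (centering d a) (centering d b) = ip a (centering d b) := by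
  rw [ip, ip, centering_apply a, conjTranspose_sub, sub_mul, ntr_sub, conjTranspose_smul,
    conjTranspose_one, smul_mul_assoc, one_mul, ntr_smul, ntr_centering hd, mul_zero, sub_zero]

theorem ip_self_eq (a : Mat d) : (ip a a).re = ‖toL2 d a‖ ^ 2 := by
  rw [← inner_toL2, ← inner_self_eq_norm_sq (𝕜 := ℂ)]; rfl

theorem norm_toL2_centering_sq_le (hd : 0 < d) {ρ : Mat d} (hρ : IsInvertibleDensity ρ) :
    ‖toL2 d (centering d ρ)‖ ^ 2 ≤ d := by
  have hd' : (d : ℂ) ≠ 0 := by exact_mod_cast hd.ne'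
  have htr : ρ.trace = d := by
    have h := hρ.2
    rwa [ntr, inv_mul_eq_one₀ hd', eq_comm] at h
  have h := trace_mul_self_le hρ.1.posSemidef
  rw [htr] at h
  have h1 : (ρ * ρ).trace = d * ntr (ρ * ρ) := by rw [ntr, mul_inv_cancel_left₀ hd']
  have h2 : (d : ℝ) * (ntr (ρ * ρ)).re ≤ d * d := by
    rw [h1] at h
    simpa using (Complex.le_def.1 h).1
  have h3 : (ntr (ρ * ρ)).re ≤ d := le_of_mul_le_mul_left h2 (by exact_mod_cast hd)
  have h4 : ip (centering d ρ) (centering d ρ) = ntr (ρ * ρ) - 1 := by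
    rw [ip_centering hd, ip, hρ.1.1.eq, centering_apply, hρ.2, one_smul, mul_sub, mul_one, ntr_sub,
      hρ.2]
  rw [← ip_self_eq, h4, Complex.sub_re, Complex.one_re]
  linarith

theorem depolarizing_satisfiesGE (hd : 0 < d) (hH : ¬ FiniteDimensional ℂ H)
    (Λ : OperatorMean H) : SatisfiesGE Λ (depolarizing d) (1 / 2) (2 * d) := by
  refine ⟨depolarizing_isQuantumMarkovSemigroup hd, depolarizing_isTraciallySymmetric,
    exists_isLindbladForm_depolarizing hd, ?_⟩
  intro n v hv V t ht a ρ hρ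
  -- Uniqueness of the generator handles all Lindblad forms at once: only the sum of the ∂_j†∂_j
  -- matters below.
  have hL : lindblad v = centering d := hv.2.unique depolarizing_isGenerator
  set e := Real.exp (-t) with he
  have he0 : 0 ≤ e := (Real.exp_pos _).le
  have he1 : e ≤ 1 := by rw [he, Real.exp_le_one_iff]; linarith
  have hPρ : depolarizing d t ρ = e • ρ + (1 - e) • 1 := by
    rw [depolarizing_apply, hρ.2, mul_one, Complex.coe_smul]
  have hgrad : gradNormSq Λ V v ρ (depolarizing d t a) = e ^ 2 * gradNormSq Λ V v ρ a := by
    have h1 : ∀ w : Mat d, partialDeriv w (depolarizing d t a) = (e : ℂ) • partialDeriv w a := by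
      intro w
      simp [depolarizing_apply, partialDeriv, ← he, mul_add, add_mul, smul_sub]
    have h2 : ∀ x : Mat d, ip (hat Λ V ρ ((e : ℂ) • x)) ((e : ℂ) • x) =
        ((e ^ 2 : ℝ) : ℂ) * ip (hat Λ V ρ x) x := by
      intro x
      simp [ip, conjTranspose_smul, ← mul_assoc, sq]
    simp only [gradNormSq, h1, h2, ← Finset.mul_sum, Complex.re_ofReal_mul]
  have hconc : e * gradNormSq Λ V v ρ a + (1 - e) * ‖toL2 d (centering d a)‖ ^ 2 ≤
      gradNormSq Λ V v (e • ρ + (1 - e) • 1) a := by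
    have h1 : ‖toL2 d (centering d a)‖ ^ 2 =
        (∑ j, ip (partialDeriv (v j) a) (partialDeriv (v j) a)).re := by
      simp only [ip_partialDeriv]
      rw [← ip_self_eq, ip_centering hd, ← hL, lindblad, LinearMap.sum_apply]
      simp only [ip, Finset.mul_sum, ntr_sum]
    rw [h1, gradNormSq, gradNormSq, Complex.re_sum, Complex.re_sum, Complex.re_sum, Finset.mul_sum,
      Finset.mul_sum, ← Finset.sum_add_distrib]
    exact Finset.sum_le_sum fun j _ =>
      ip_hat_comb_ge hH Λ V hρ.1.posSemidef he0 (sub_nonneg.2 he1) _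
  have hip : ‖ip a (lindblad v (depolarizing d t ρ))‖ ^ 2 ≤
      e ^ 2 * (‖toL2 d (centering d a)‖ ^ 2 * d) := by
    have h1 : ip a (lindblad v (depolarizing d t ρ)) =
        e * ip (centering d a) (centering d ρ) := by
      have h2 : centering d (depolarizing d t ρ) = (e : ℂ) • centering d ρ := by
        rw [depolarizing_eq, map_sub, LinearMap.map_smul_of_tower, centering_centering hd, ← he,
          ← Complex.coe_smul]
        push_cast
        module
      rw [hL, h2, ip_centering hd, ip, mul_smul_comm, ntr_smul, ip]
    rw [h1, norm_mul, mul_pow, ← inner_toL2, Complex.norm_real, Real.norm_of_nonneg he0]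
    gcongr
    calc _ ≤ (‖toL2 d (centering d a)‖ * ‖toL2 d (centering d ρ)‖) ^ 2 := by
          gcongr; exact norm_inner_le_norm _ _
      _ ≤ _ := by
          rw [mul_pow]
          gcongr
          exact norm_toL2_centering_sq_le hd hρ
  have hcoef : dimCoeff (1 / 2) (2 * d) t = (1 - e) / d := by
    rw [dimCoeff, if_neg (by norm_num), he]
    congr 2 <;> ring_nf
  have hexp : Real.exp (-2 * (1 / 2) * t) = e := by rw [he]; ring_nf
  rw [hgrad, hcoef, hexp]
  rw [hPρ] at hip ⊢
  set X := ‖toL2 d (centering d a)‖ ^ 2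
  have hX : 0 ≤ X := sq_nonneg _
  have hdim := mul_le_mul_of_nonneg_left hip
    (show 0 ≤ (1 - e) / (d : ℝ) from div_nonneg (sub_nonneg.2 he1) d.cast_nonneg)
  have hdR : (d : ℝ) ≠ 0 := by exact_mod_cast hd.ne'
  have hdim' : (1 - e) / (d : ℝ) * (e ^ 2 * (X * d)) = e * (e * (1 - e) * X) := by field_simp
  -- The dimension term carries a spare factor e ≤ 1, which is discarded.
  have hle : e * (e * (1 - e) * X) ≤ e * (1 - e) * X :=
    mul_le_of_le_one_left (mul_nonneg (mul_nonneg he0 (sub_nonneg.2 he1)) hX) he1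
  have hmain := mul_le_mul_of_nonneg_left hconc he0
  rw [hdim'] at hdim
  linarith

end GradientEstimate
end QMS

theorem mainTheorem11 (d : ℕ) (hd : 0 < d) :
    (∀ (H : Type*) [NormedAddCommGroup H] [InnerProductSpace ℂ H] [CompleteSpace H],
      ¬ FiniteDimensional ℂ H → ∀ Λ : QMS.OperatorMean H,
        QMS.SatisfiesGE Λ (QMS.depolarizing d) (1 / 2) (2 * d)) ∧
    QMS.SatisfiesBE (QMS.depolarizing d) (1 / 2) (2 * d) :=
  ⟨fun _ _ _ _ hH Λ => QMS.depolarizing_satisfiesGE hd hH Λ, QMS.depolarizing_satisfiesBE hd⟩
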